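/- Let $F=(F,\mathcal G_0,\nu)$ be a commutative supertropical semifield: a commutative semiring with a ghost ideal $\mathcal G_0\ni 0$ and idempotent, multiplicative ghost map $\nu(a)=a^\nu=a+a\in\mathcal G_0$, such that $a+b=a^\nu$ if $a^\nu=b^\nu$ and $a+b\in\{a,b\}$ otherwise, the set $\mathcal T=F\setminus\mathcal G_0$ of tangible elements is a multiplicative group with identity $1$, and $\nu$ maps $\mathcal T$ onto $\mathcal G_0\setminus\{0\}$. For $a,b\in F$ write $a\models b$ if $a=b+c$ with $c\in\mathcal G_0$; in a subspace $V\subseteq F^{(n)}$ write $v\models w$ if $v=w+u$ with $u\in V\cap\mathcal G_0^{(n)}$. For a subspace $W\subseteq F^{(n)}$ let $\operatorname{Hom}(W,F)$ be the $F$-module of all functions $\ell:W\to F$ with $\ell(v+w)\models \ell(v)+\ell(w)$, $\ell(av)=a\ell(v)$ and $\ell(W\cap\mathcal G_0^{(n)})\subseteq\mathcal G_0$; its ghosts are the functionals with all values in $\mathcal G_0$, and $\ell\models \ell'$ on $W$ means $\ell(v)\models\ell'(v)$ for all $v\in W$. A set $S$ is tropically independent if no combination of finitely many (at least one) distinct elements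 of $S$ with tangible coefficients is ghost; a d-base is a maximal tropically independent subset. An s-base is a set $S$ that is minimal with the property that every vector $v$ of the space satisfies $v\models\sum_{i}\alpha_i w_i$ for some finite (possibly empty) family of distinct $w_i\in S$ and tangible $\alpha_i$. For an $n\times n$ matrix $A$ let $|A|$ be its permanent and, if $|A|$ is tangible ($A$ nonsingular), put $A^\nabla=|A|^{-1}\operatorname{adj}(A)$, where $\operatorname{adj}(A)_{ij}$ is the permanent of $A$ without row $j$ and column $i$, and $I_A=AA^\nabla$. A d-base $\{b_1,\dots,b_n\}$ of a subspace of $F^{(n)}$, with row matrix $A$ (rows $b_1,\dots,b_n$), is closed if $I_AA=A$. A family of functionals $v\mapsto\sum_k c_{ik}v_k$ is called closed if the coefficient matrix $C=(c_{ik})$ is nonsingular and $I_CC=C$. **Theorem.** Let $\mathcal B=\{b_1,\dots,b_n\}$ ($n$ distinct vectors) be a closed s-base (that is, an s-base which is also a closed d-base) of a subspace $V\subseteq F^{(n)}$, with row matrix $A$, and put $A_{\mathcal B}=I_AA$. (a) Writing vectors as rows, let $V_{\mathcal B}$ be the subspace spanned by the rows of $A_{\mathcal B}$, and let $\epsilon_i(v)$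 be the $i$-th coordinate of $vA^\nabla$ ($v\in V_{\mathcal B}$). Then $\epsilon_1,\dots,\epsilon_n$ are distinct and $\{\epsilon_1,\dots,\epsilon_n\}$ is a closed s-base, and also a d-base, of $V_{\mathcal B}^*=\operatorname{Hom}(V_{\mathcal B},F)$; in particular it has the same rank $n$ as $\mathcal B$. (b) Writing vectors as columns, the same holds for $V_{\mathcal B}=\{A_{\mathcal B}x: x\in F^{(n)}\}$ and $\epsilon_i(v)=b_i^{\,t}A^\nabla v$, the functional with coefficient vector $b_i^{\,t}A^\nabla$. -/

import Mathlib

/-- A (commutative) supertropical semifield `(F, 𝒢₀, ν)`, with zero element adjoined.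
`ghost` is the ghost ideal `𝒢₀ = 𝒢 ∪ {0}`, the ghost map is `ν a = a + a`, and the tangible elements
are those outside `ghost`. -/
class SupertropicalSemifield (F : Type*) extends CommSemiring F where
  ghost : Ideal F
  add_self_mem_ghost : ∀ a : F, a + a ∈ ghost
  nu_idem : ∀ a : F, (a + a) + (a + a) = a + a
  nu_mul : ∀ a b : F, a * b + a * b = (a + a) * (b + b)
  add_eq_nu : ∀ a b : F, a + a = b + b → a + b = a + a
  add_eq_or : ∀ a b : F, a + a ≠ b + b → a + b = a ∨ a + b = b
  one_not_mem_ghost : (1 : F) ∉ ghost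
  mul_not_mem_ghost : ∀ a b : F, a ∉ ghost → b ∉ ghost → a * b ∉ ghost
  exists_inv : ∀ a : F, a ∉ ghost → ∃ b : F, b ∉ ghost ∧ a * b = 1
  nu_onto : ∀ g ∈ ghost, g ≠ 0 → ∃ a : F, a ∉ ghost ∧ a + a = g

namespace Supertropical

open Matrix

/-- Tangible elements, `𝒯 = F \ 𝒢₀`. -/
def IsTangible {F : Type*} [SupertropicalSemifield F] (a : F) : Prop :=
  a ∉ (SupertropicalSemifield.ghost : Ideal F)

section Modules

variable {F : Type*} [SupertropicalSemifield F] {M : Type*} [AddCommMonoid M] [Module F M]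

/-- `v` ghost surpasses `w`, relative to the ghost submodule `H`. -/
def GhostSurpasses (H : Submodule F M) (v w : M) : Prop :=
  ∃ u ∈ H, v = w + u

/-- Some combination of finitely many (at least one) distinct elements of `S`, with tangible
coefficients, is a ghost. -/
def TropicallyDependent (H : Submodule F M) (S : Set M) : Prop :=
  ∃ t : Finset M, t.Nonempty ∧ (t : Set M) ⊆ S ∧
    ∃ α : M → F, (∀ w ∈ t, IsTangible (α w)) ∧ ∑ w ∈ t, α w • w ∈ H

def TropicallyIndependent (H : Submodule F M) (S : Set M) : Prop :=
  ¬ TropicallyDependent H S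

/-- `v` ghost surpasses a combination of finitely many elements of `S` with tangible coefficients.
The empty combination is allowed, so that `0` is tropically spanned by every set. -/
def TropicallySpanned (H : Submodule F M) (S : Set M) (v : M) : Prop :=
  ∃ t : Finset M, (t : Set M) ⊆ S ∧
    ∃ α : M → F, (∀ w ∈ t, IsTangible (α w)) ∧ GhostSurpasses H v (∑ w ∈ t, α w • w)

/-- `S` is a d-base of `V`: a maximal tropically independent subset of `V`. -/
def IsDBase (H V : Submodule F M) (S : Set M) : Prop :=
  S ⊆ V ∧ TropicallyIndependent H S ∧
    ∀ S' : Set M, S' ⊆ V → S ⊆ S' → TropicallyIndependent H S' → S' = S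

/-- `S` is an s-base of `V`: a minimal subset of `V` tropically spanning `V`. -/
def IsSBase (H V : Submodule F M) (S : Set M) : Prop :=
  S ⊆ V ∧ (∀ v ∈ V, TropicallySpanned H S v) ∧
    ∀ S' : Set M, S' ⊂ S → ¬ ∀ v ∈ V, TropicallySpanned H S' v

end Modules

/-- The ghost submodule of a space of functions `ι → F`: the functions with all values in `𝒢₀`.
For `ι = Fin n` this is `𝒢₀^(n) ⊆ F^(n)`. The relation `GhostSurpasses (ghostFun F ι)` is ghost
surpassing at every point of `ι`. -/
def ghostFun (F : Type*) [SupertropicalSemifield F] (ι : Type*) : Submodule F (ι → F) :=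
  Submodule.pi Set.univ fun _ => (SupertropicalSemifield.ghost : Ideal F)

/-- `Hom(V, F)`: the supertropical maps from the vector space `V` with ghost submodule `H` to `F`,
as a subspace of the space of all functions `V → F`. -/
def dualSpace {F : Type*} [SupertropicalSemifield F] {V : Type*} [AddCommMonoid V] [Module F V]
    (H : Submodule F V) : Submodule F (V → F) where
  carrier := {l | (∀ v w : V,
      GhostSurpasses (SupertropicalSemifield.ghost : Ideal F) (l (v + w)) (l v + l w)) ∧
    (∀ (a : F) (v : V), l (a • v) = a * l v) ∧
    ∀ v ∈ H, l v ∈ (SupertropicalSemifield.ghost : Ideal F)}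
  zero_mem' := ⟨fun _ _ => ⟨0, Submodule.zero_mem _, by simp⟩, fun _ _ => by simp,
    fun _ _ => Submodule.zero_mem _⟩
  add_mem' := by
    rintro l m ⟨h1, h2, h3⟩ ⟨k1, k2, k3⟩
    refine ⟨fun v w => ?_, fun a v => ?_, fun v hv => ?_⟩
    · obtain ⟨u, hu, e⟩ := h1 v w
      obtain ⟨u', hu', e'⟩ := k1 v w
      refine ⟨u + u', Submodule.add_mem _ hu hu', ?_⟩
      simp only [Pi.add_apply, e, e']
      abel
    · simp only [Pi.add_apply, h2, k2, mul_add]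
    · exact Submodule.add_mem _ (h3 v hv) (k3 v hv)
  smul_mem' := by
    rintro c l ⟨h1, h2, h3⟩
    refine ⟨fun v w => ?_, fun a v => ?_, fun v hv => ?_⟩
    · obtain ⟨u, hu, e⟩ := h1 v w
      refine ⟨c * u, Ideal.mul_mem_left _ c hu, ?_⟩
      simp only [Pi.smul_apply, smul_eq_mul, e, mul_add]
    · simp only [Pi.smul_apply, smul_eq_mul, h2, mul_left_comm]
    · exact Ideal.mul_mem_left _ c (h3 v hv)

section Matrices

variable {F : Type*} [SupertropicalSemifield F] {n : ℕ}

/-- The adjoint matrix `adj A`: its `(i, j)` entry is the tropical determinant (permanent) of the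
minor of `A` without row `j` and column `i`, written here as the permanent of the matrix `A`
with row `j` replaced by the `i`-th standard basis vector. -/
def adj (A : Matrix (Fin n) (Fin n) F) : Matrix (Fin n) (Fin n) F :=
  Matrix.of fun i j => (A.updateRow j (Pi.single i 1)).permanent

/-- `A` is nonsingular: the tropical determinant `|A|` (the permanent) is tangible. -/
def Nonsingular (A : Matrix (Fin n) (Fin n) F) : Prop :=
  IsTangible A.permanent

/-- `A^∇ = |A|⁻¹ adj A`, for nonsingular `A`. (The invertible elements of `F` are the tangible ones;
for singular `A` this matrix is `0`.) -/
noncomputable def nabla (A : Matrix (Fin n) (Fin n) F) : Matrix (Fin n) (Fin n) F :=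
  Ring.inverse A.permanent • adj A

/-- `I_A = A A^∇`. -/
noncomputable def quasiId (A : Matrix (Fin n) (Fin n) F) : Matrix (Fin n) (Fin n) F :=
  A * nabla A

/-- The matrix `A_B = I_A A`, where `A` is the matrix with rows `b 0, …, b (n - 1)`. -/
noncomputable def closureMatrix (b : Fin n → Fin n → F) : Matrix (Fin n) (Fin n) F :=
  quasiId (Matrix.of b) * Matrix.of b

/-- The vectors `b 0, …, b (n - 1)` of `F^(n)`, with row matrix `A`, are closed: `I_A A = A`. -/
def IsClosedFamily (b : Fin n → Fin n → F) : Prop :=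
  closureMatrix b = Matrix.of b

/-- `V_B` with vectors written as rows: the subspace spanned by the rows of `A_B`. -/
noncomputable def rowSpace (b : Fin n → Fin n → F) : Submodule F (Fin n → F) :=
  Submodule.span F (Set.range fun i => closureMatrix b i)

/-- `V_B` with vectors written as columns: the subspace `{A_B x : x ∈ F^(n)}`. -/
noncomputable def colSpace (b : Fin n → Fin n → F) : Submodule F (Fin n → F) :=
  LinearMap.range (closureMatrix b).mulVecLin

/-- With rows: `ε_i(v)` is the `i`-th coordinate of `v A^∇`. -/
noncomputable def rowDual (b : Fin n → Fin n → F) (i : Fin n) : rowSpace b → F :=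
  fun v => ((v : Fin n → F) ᵥ* nabla (Matrix.of b)) i

/-- With columns: `ε_i(v) = b_iᵗ A^∇ v`. -/
noncomputable def colDual (b : Fin n → Fin n → F) (i : Fin n) : colSpace b → F :=
  fun v => b i ⬝ᵥ (nabla (Matrix.of b) *ᵥ (v : Fin n → F))

/-- `ε 0, …, ε (n - 1)` is a closed s-base, with `n` distinct elements, of the dual space
`Hom(W, F)` of the subspace `W` of `F^(n)`; the functional `ε i` has coefficient vector `c i`, and
closedness is that of the coefficient vectors. Ghost surpassing between functionals is understood
at every point of `W`. -/
structure IsClosedSBaseOfDual (W : Submodule F (Fin n → F)) (ε : Fin n → W → F)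
    (c : Fin n → Fin n → F) : Prop where
  coeff : ∀ (i : Fin n) (v : W), ε i v = c i ⬝ᵥ (v : Fin n → F)
  injective : Function.Injective ε
  sBase : IsSBase (ghostFun F W) (dualSpace ((ghostFun F (Fin n)).comap W.subtype)) (Set.range ε)
  dBase : IsDBase (ghostFun F W) (dualSpace ((ghostFun F (Fin n)).comap W.subtype)) (Set.range ε)
  nonsingular : Nonsingular (Matrix.of c)
  closed : IsClosedFamily c

end Matrices

end Supertropical

/-! Call `E` a quasi-identity if it is idempotent, with ones on the diagonal and ghosts off it.
Idempotency gives the triangle inequality `E i k * E k j ≤ E i j` in ν-value. A ghost summand of a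
sum equal to 1 lies strictly below 1, so every nontrivial cycle has weight below 1. Hence the
permanent of `E` is 1, `adj E = E` and `nabla E = E`. A closed nonsingular matrix is a
quasi-identity up to permuting and rescaling rows (`exists_quasiIdentity`).

With rows, `A` has the same row space as such an `E`, which fixes that space, so the `ε_i` are
coordinate functions up to a permutation and tangible factors. With columns, `I_A` is itself a
quasi-identity fixing the column space, and `ε_i(v) = v_i`. Both parts reduce to
`dual_bases_of_quasiIdentity`: the rows of the quasi-identity are nearly dual to the coordinates,
which yields spanning and minimality, while independence comes from a dominance argument. The
coefficient matrices are again row-rescaled quasi-identities, hence closed. -/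

namespace Supertropical

open Matrix SupertropicalSemifield

/-! ### The total preorder by ν-value, and ghost or tangible sums. -/

section Order

variable {F : Type*} [SupertropicalSemifield F]

/-- Comparison of `ν`-values: `a^ν ≤ b^ν` in the totally ordered ghost ideal. -/
def NuLE (a b : F) : Prop := (a + a) + (b + b) = b + b

def NuLT (a b : F) : Prop := NuLE a b ∧ ¬ NuLE b a

theorem nuLE_refl (a : F) : NuLE a a := nu_idem a

theorem NuLE.trans {a b c : F} (h : NuLE a b) (k : NuLE b c) : NuLE a c := by
  unfold NuLE at *
  rw [← k, ← add_assoc, h]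

theorem nuLE_of_nu_eq {a b : F} (h : a + a = b + b) : NuLE a b := by
  unfold NuLE
  rw [h, nu_idem]

theorem NuLE.nu_eq {a b : F} (h : NuLE a b) (k : NuLE b a) : a + a = b + b := by
  unfold NuLE at *
  rw [← h, add_comm (a + a), k]

theorem nuLE_total (a b : F) : NuLE a b ∨ NuLE b a := by
  by_cases h : a + a = b + b
  · exact .inl (nuLE_of_nu_eq h)
  · have h' : (a + a) + (a + a) ≠ (b + b) + (b + b) := by rwa [nu_idem, nu_idem]
    rcases add_eq_or _ _ h' with e | e
    · right
      unfold NuLE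
      rw [add_comm, e]
    · exact .inl e

theorem NuLT.of_not_le {a b : F} (h : ¬ NuLE b a) : NuLT a b :=
  ⟨(nuLE_total a b).resolve_right h, h⟩

theorem NuLE.trans_lt {a b c : F} (h : NuLE a b) (k : NuLT b c) : NuLT a c :=
  ⟨h.trans k.1, fun e => k.2 (e.trans h)⟩

theorem NuLE.mul_left (c : F) {a b : F} (h : NuLE a b) : NuLE (c * a) (c * b) := by
  unfold NuLE at *
  rw [← mul_add, ← mul_add, ← mul_add, h]

theorem NuLE.mul_right (c : F) {a b : F} (h : NuLE a b) : NuLE (a * c) (b * c) := by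
  rw [mul_comm a, mul_comm b]
  exact h.mul_left c

theorem NuLE.of_mul_left {u a b : F} (hu : IsUnit u) (h : NuLE (u * a) (u * b)) : NuLE a b := by
  obtain ⟨u, rfl⟩ := hu
  simpa using h.mul_left (↑u⁻¹ : F)

theorem nuLE_add_right (a b : F) : NuLE a (a + b) := by
  unfold NuLE
  rw [add_add_add_comm a b, ← add_assoc, nu_idem]

theorem zero_nuLE (a : F) : NuLE 0 a := by simp [NuLE]

theorem NuLE.add {a b c : F} (h : NuLE a c) (k : NuLE b c) : NuLE (a + b) c := by
  unfold NuLE at *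
  rw [add_add_add_comm a b, add_assoc, k, h]

theorem nuLE_sum {ι : Type*} {s : Finset ι} (f : ι → F) {i : ι} (hi : i ∈ s) :
    NuLE (f i) (∑ j ∈ s, f j) := by
  classical
  rw [← Finset.add_sum_erase _ _ hi]
  exact nuLE_add_right _ _

theorem sum_nuLE {ι : Type*} {s : Finset ι} {f : ι → F} {b : F} (h : ∀ i ∈ s, NuLE (f i) b) :
    NuLE (∑ j ∈ s, f j) b :=
  Finset.sum_induction f (NuLE · b) (fun _ _ => NuLE.add) (zero_nuLE b) h

theorem nu_eq_self_of_mem_ghost {g : F} (hg : g ∈ (ghost : Ideal F)) : g + g = g := by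
  by_cases h : g = 0
  · simp [h]
  · obtain ⟨a, -, rfl⟩ := nu_onto g hg h
    exact nu_idem a

/-- Ghosts are determined by their ν-value, so matrix identities off the diagonal reduce to two
inequalities. -/
theorem eq_of_mem_ghost {a b : F} (ha : a ∈ (ghost : Ideal F)) (hb : b ∈ (ghost : Ideal F))
    (h : NuLE a b) (k : NuLE b a) : a = b := by
  rw [← nu_eq_self_of_mem_ghost ha, ← nu_eq_self_of_mem_ghost hb, h.nu_eq k]

theorem add_eq_right_of_nuLT {a b : F} (h : NuLT a b) : a + b = b := by
  have hne : a + a ≠ b + b := fun e => h.2 (nuLE_of_nu_eq e.symm)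
  refine (add_eq_or a b hne).resolve_left fun e => h.2 ?_
  have := nuLE_add_right b a
  rwa [add_comm b a, e] at this

theorem add_mem_ghost_of_nuLE {a g : F} (hg : g ∈ (ghost : Ideal F)) (h : NuLE a g) :
    a + g ∈ (ghost : Ideal F) := by
  by_cases k : NuLE g a
  · rw [add_eq_nu a g (h.nu_eq k)]
    exact add_self_mem_ghost a
  · rwa [add_eq_right_of_nuLT ⟨h, k⟩]

/-- Also used by contradiction: in a sum equal to 1, each ghost summand is strictly below 1. -/
theorem sum_mem_ghost_of_nuLE {ι : Type*} {s : Finset ι} {f : ι → F} {i : ι} (hi : i ∈ s)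
    (hg : f i ∈ (ghost : Ideal F)) (h : NuLE (∑ j ∈ s, f j) (f i)) :
    ∑ j ∈ s, f j ∈ (ghost : Ideal F) := by
  classical
  rw [← Finset.sum_erase_add _ _ hi] at h ⊢
  exact add_mem_ghost_of_nuLE hg ((nuLE_add_right _ _).trans h)

theorem add_eq_or_of_isTangible {a b : F} (h : IsTangible (a + b)) : a + b = a ∨ a + b = b := by
  refine add_eq_or a b fun e => h ?_
  rw [add_eq_nu a b e]
  exact add_self_mem_ghost a

/-- A tangible sum equals one of its summands. -/
theorem exists_sum_eq_of_isTangible {ι : Type*} (s : Finset ι) (f : ι → F)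
    (h : IsTangible (∑ i ∈ s, f i)) : ∃ i ∈ s, ∑ i ∈ s, f i = f i := by
  classical
  induction s using Finset.induction_on with
  | empty => simp [IsTangible] at h
  | insert a s ha ih =>
    rw [Finset.sum_insert ha] at h ⊢
    rcases add_eq_or_of_isTangible h with e | e
    · exact ⟨a, Finset.mem_insert_self _ _, e⟩
    · rw [e] at h ⊢
      obtain ⟨i, hi, hf⟩ := ih h
      exact ⟨i, Finset.mem_insert_of_mem hi, hf⟩

theorem NuLT.add {a b c : F} (h : NuLT a c) (k : NuLT b c) : NuLT (a + b) c := by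
  rcases nuLE_total a b with e | e
  · exact ((e.add (nuLE_refl b)).trans_lt k)
  · exact (((nuLE_refl a).add e).trans_lt h)

/-- `h0` is needed because the remaining summands may form the empty sum. -/
theorem sum_eq_of_dominant {ι : Type*} {s : Finset ι} {f : ι → F} {i : ι} (hi : i ∈ s)
    (h0 : NuLT 0 (f i)) (h : ∀ j ∈ s, j ≠ i → NuLT (f j) (f i)) : ∑ j ∈ s, f j = f i := by
  classical
  rw [← Finset.sum_erase_add _ _ hi]
  refine add_eq_right_of_nuLT ?_
  refine Finset.sum_induction f (NuLT · (f i)) (fun _ _ => NuLT.add) h0 fun j hj => ?_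
  exact h j (Finset.mem_of_mem_erase hj) (Finset.ne_of_mem_erase hj)

theorem isTangible_one : IsTangible (1 : F) := one_not_mem_ghost

theorem isTangible_iff_isUnit {a : F} : IsTangible a ↔ IsUnit a := by
  constructor
  · intro h
    obtain ⟨b, -, e⟩ := exists_inv a h
    exact IsUnit.of_mul_eq_one b e
  · rintro ⟨u, rfl⟩ h
    refine one_not_mem_ghost (F := F) ?_
    rw [← u.mul_inv]
    exact Ideal.mul_mem_right _ _ h

theorem zero_nuLT_of_isTangible {a : F} (h : IsTangible a) : NuLT 0 a := by
  refine ⟨zero_nuLE a, fun k => h ?_⟩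
  have e : a + a = 0 + 0 := k.nu_eq (zero_nuLE a)
  have := add_eq_nu a 0 e
  rw [add_zero] at this
  rw [this]
  exact add_self_mem_ghost a

end Order

/-! ### Permanents, adjoints, and their behaviour under row operations. -/

section Permanent

variable {F : Type*} [SupertropicalSemifield F] {n : ℕ}

theorem permanent_updateRow (A : Matrix (Fin n) (Fin n) F) (j : Fin n) (r : Fin n → F) :
    (A.updateRow j r).permanent =
      ∑ σ : Equiv.Perm (Fin n), r (σ⁻¹ j) * ∏ k ∈ Finset.univ.erase (σ⁻¹ j), A (σ k) k := by
  refine Finset.sum_congr rfl fun σ _ => ?_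
  rw [← Finset.mul_prod_erase _ _ (Finset.mem_univ (σ⁻¹ j))]
  congr 1
  · simp
  · refine Finset.prod_congr rfl fun k hk => ?_
    rw [updateRow_ne]
    rintro rfl
    simp at hk

/-- Each term is a product along a permutation with the edge from `i` to `j` removed, the shape
bounded later by open paths. -/
theorem adj_apply (A : Matrix (Fin n) (Fin n) F) (i j : Fin n) :
    adj A i j = ∑ σ : Equiv.Perm (Fin n),
      if σ i = j then ∏ k ∈ Finset.univ.erase i, A (σ k) k else 0 := by
  rw [adj, of_apply, permanent_updateRow]
  refine Finset.sum_congr rfl fun σ _ => ?_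
  by_cases h : σ i = j
  · subst h
    simp
  · rw [if_neg h, Pi.single_eq_of_ne, zero_mul]
    rintro rfl
    simp at h

/-- Expansion of the permanent along a row. -/
theorem mul_adj_apply (A : Matrix (Fin n) (Fin n) F) (i k : Fin n) :
    (A * adj A) i k = (A.updateRow k (A i)).permanent := by
  simp only [mul_apply, adj, of_apply, permanent_updateRow, Finset.mul_sum]
  rw [Finset.sum_comm]
  refine Finset.sum_congr rfl fun σ _ => ?_
  rw [Finset.sum_eq_single (σ⁻¹ k)]
  · simp
  · intro l _ hl
    rw [Pi.single_eq_of_ne hl.symm, zero_mul, mul_zero]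
  · simp

/-- Composing with the transposition of `i` and `k` matches even with odd permutations and preserves
terms, so the permanent has the form `x + x`. -/
theorem permanent_mem_ghost_of_row_eq (A : Matrix (Fin n) (Fin n) F) {i k : Fin n} (hik : i ≠ k)
    (h : A i = A k) : A.permanent ∈ (ghost : Ideal F) := by
  have hrow : ∀ l, A (Equiv.swap i k l) = A l := fun l => by
    by_cases h1 : l = i
    · subst h1; rw [Equiv.swap_apply_left, h]
    by_cases h2 : l = k
    · subst h2; rw [Equiv.swap_apply_right, h]
    rw [Equiv.swap_apply_of_ne_of_ne h1 h2]
  rw [permanent, ← Finset.sum_filter_add_sum_filter_not _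
    (fun σ : Equiv.Perm (Fin n) => Equiv.Perm.sign σ = 1)]
  convert add_self_mem_ghost (F := F) _ using 2
  refine Finset.sum_equiv (Equiv.mulLeft (Equiv.swap i k)) (fun σ => ?_) fun σ _ => ?_
  · rcases Int.units_eq_one_or (Equiv.Perm.sign σ) with e | e <;>
      simp [e, Equiv.Perm.sign_swap hik]
  · simp [hrow]

theorem permanent_diagonal_mul (d : Fin n → F) (A : Matrix (Fin n) (Fin n) F) :
    (diagonal d * A).permanent = (∏ i, d i) * A.permanent := by
  simp only [permanent, diagonal_mul, Finset.prod_mul_distrib, Finset.mul_sum]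
  refine Finset.sum_congr rfl fun σ _ => ?_
  rw [Equiv.prod_comp σ d]

theorem adj_diagonal_mul (d : Fin n → Fˣ) (A : Matrix (Fin n) (Fin n) F) :
    adj (diagonal (fun i => (d i : F)) * A) =
      ((∏ i, d i : Fˣ) : F) • (adj A * diagonal fun i => (((d i)⁻¹ : Fˣ) : F)) := by
  ext i j
  -- The replaced row is not rescaled, so its factor is 1 rather than `d j`.
  have : (diagonal (fun i => (d i : F)) * A).updateRow j (Pi.single i 1) =
      diagonal (Function.update (fun i => (d i : F)) j 1) * A.updateRow j (Pi.single i 1) := by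
    ext r s
    rw [diagonal_mul]
    by_cases h : r = j
    · subst h; simp
    · simp [h, diagonal_mul]
  simp only [adj, of_apply, this, permanent_diagonal_mul, Matrix.smul_apply, smul_eq_mul, mul_diagonal]
  rw [← Finset.mul_prod_erase _ d (Finset.mem_univ j),
    ← Finset.mul_prod_erase _ (Function.update _ j 1) (Finset.mem_univ j),
    Finset.prod_congr rfl fun k hk => Function.update_of_ne (Finset.ne_of_mem_erase hk) _ _]
  push_cast
  rw [Function.update_self, one_mul]
  calc _ = (d j * ((d j)⁻¹ : Fˣ) : F) * ((∏ k ∈ Finset.univ.erase j, (d k : F)) *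
        (A.updateRow j (Pi.single i 1)).permanent) := by rw [Units.mul_inv, one_mul]
    _ = _ := by ring

theorem adj_submatrix_left (σ : Equiv.Perm (Fin n)) (A : Matrix (Fin n) (Fin n) F) :
    adj (A.submatrix σ id) = (adj A).submatrix id σ := by
  ext i j
  have : (A.submatrix σ id).updateRow j (Pi.single i 1) =
      (A.updateRow (σ j) (Pi.single i 1)).submatrix σ id := by
    ext r s
    by_cases h : r = j
    · subst h; simp
    · simp [h]
  simp [adj, this, permanent_permute_cols]

theorem inverse_mul_units (u : Fˣ) (a : F) :
    Ring.inverse (u * a) = (u⁻¹ : Fˣ) * Ring.inverse a := by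
  rw [Ring.mul_inverse_rev, Ring.inverse_unit, mul_comm]

/-- `A^∇` for a matrix obtained by permuting and rescaling rows. -/
theorem nabla_diagonal_mul_submatrix (d : Fin n → Fˣ) (σ : Equiv.Perm (Fin n))
    (A : Matrix (Fin n) (Fin n) F) :
    nabla (diagonal (fun i => (d i : F)) * A.submatrix σ id) =
      (nabla A).submatrix id σ * diagonal fun i => (((d i)⁻¹ : Fˣ) : F) := by
  rw [nabla, permanent_diagonal_mul, permanent_permute_cols, adj_diagonal_mul, adj_submatrix_left,
    ← Units.coe_prod, inverse_mul_units, smul_smul, nabla]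
  rw [mul_right_comm, Units.inv_mul, one_mul, ← Matrix.smul_mul]
  rfl

theorem quasiId_apply_self {A : Matrix (Fin n) (Fin n) F} (hA : Nonsingular A) (i : Fin n) :
    quasiId A i i = 1 := by
  rw [quasiId, nabla, Matrix.mul_smul, Matrix.smul_apply, mul_adj_apply, updateRow_eq_self, smul_eq_mul,
    Ring.inverse_mul_cancel _ (isTangible_iff_isUnit.1 hA)]

/-- The entry is a multiple of the permanent of `A` with row `j` overwritten by row `i`. -/
theorem quasiId_apply_mem_ghost (A : Matrix (Fin n) (Fin n) F) {i j : Fin n} (h : i ≠ j) :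
    quasiId A i j ∈ (ghost : Ideal F) := by
  rw [quasiId, nabla, Matrix.mul_smul, Matrix.smul_apply, mul_adj_apply]
  exact Ideal.mul_mem_left _ _ (permanent_mem_ghost_of_row_eq _ h (by simp [h]))

end Permanent

/-! ### Quasi-identity matrices and the normal form of closed matrices. -/

section QuasiIdentity

variable {F : Type*} [SupertropicalSemifield F] {n : ℕ}

/-- Quasi-identity matrices: idempotent, with unit diagonal and ghosts off the diagonal. -/
structure IsQuasiIdentity (E : Matrix (Fin n) (Fin n) F) : Prop where
  diag : ∀ i, E i i = 1
  offDiag : ∀ i j, i ≠ j → E i j ∈ (ghost : Ideal F)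
  idem : E * E = E

namespace IsQuasiIdentity

variable {E : Matrix (Fin n) (Fin n) F}

theorem transpose (hE : IsQuasiIdentity E) : IsQuasiIdentity Eᵀ :=
  ⟨hE.diag, fun i j h => hE.offDiag j i h.symm, by rw [← transpose_mul, hE.idem]⟩

theorem mul_nuLE (hE : IsQuasiIdentity E) (i k j : Fin n) : NuLE (E i k * E k j) (E i j) := by
  have := nuLE_sum (fun k => E i k * E k j) (Finset.mem_univ k)
  rwa [← mul_apply, hE.idem] at this

/-- The product is a ghost summand of `(E * E) i i = 1`, which is tangible. -/
theorem mul_nuLT_one (hE : IsQuasiIdentity E) {i k : Fin n} (h : i ≠ k) :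
    NuLT (E i k * E k i) 1 := by
  refine NuLT.of_not_le fun hle => ?_
  have hsum : ∑ k, E i k * E k i = 1 := by rw [← mul_apply, hE.idem, hE.diag]
  refine one_not_mem_ghost (F := F) ?_
  rw [← hsum] at hle ⊢
  exact sum_mem_ghost_of_nuLE (Finset.mem_univ k) (Ideal.mul_mem_right _ _ (hE.offDiag i k h)) hle

theorem prod_eq_prod_erase (hE : IsQuasiIdentity E) {σ : Equiv.Perm (Fin n)} {j : Fin n}
    (h : σ j = j) : ∏ k, E (σ k) k = ∏ k ∈ Finset.univ.erase j, E (σ k) k := by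
  rw [← Finset.mul_prod_erase _ _ (Finset.mem_univ j), h, hE.diag, one_mul]

/-- A product of entries along the cycles of `σ`, with one edge removed, is bounded by the entry
completing the open path. -/
theorem prod_erase_nuLE (hE : IsQuasiIdentity E) (σ : Equiv.Perm (Fin n)) (j : Fin n) :
    NuLE (∏ k ∈ Finset.univ.erase j, E (σ k) k) (E j (σ j)) := by
  induction hm : σ.support.card using Nat.strong_induction_on generalizing σ j with
  | _ m ih =>
    subst hm
    have moved : ∀ j, σ j ≠ j → NuLE (∏ k ∈ Finset.univ.erase j, E (σ k) k) (E j (σ j)) := by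
      intro j hj
      have hi : σ (σ j) ≠ σ j := fun e => hj (σ.injective e)
      -- `τ` bypasses `σ j`: it sends `j` straight to `σ (σ j)` and fixes `σ j`, so its support
      -- shrinks. The triangle inequality restores the removed edge.
      set τ := Equiv.swap (σ j) (σ (σ j)) * σ with hτ
      have hlt : τ.support.card < σ.support.card := Equiv.Perm.card_support_swap_mul hi
      have hτj : τ j = σ (σ j) := by simp [hτ]
      have hτi : τ (σ j) = σ j := by simp [hτ]
      have hmem : σ j ∈ Finset.univ.erase j := by simp [hj]
      have hprod : ∏ k ∈ Finset.univ.erase j, E (σ k) k =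
          (∏ k ∈ Finset.univ.erase j, E (τ k) k) * E (σ (σ j)) (σ j) := by
        rw [← Finset.prod_erase_mul _ _ hmem, ← Finset.prod_erase_mul _ (fun k => E (τ k) k) hmem,
          hτi, hE.diag, mul_one]
        congr 1
        refine Finset.prod_congr rfl fun k hk => ?_
        have h1 : k ≠ σ j := Finset.ne_of_mem_erase hk
        have h2 : k ≠ j := Finset.ne_of_mem_erase (Finset.mem_of_mem_erase hk)
        rw [hτ, Equiv.Perm.mul_apply, Equiv.swap_apply_of_ne_of_ne]
        · exact fun e => h2 (σ.injective e)
        · exact fun e => h1 (σ.injective e)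
      rw [hprod]
      refine ((ih _ hlt τ j rfl).mul_right _).trans ?_
      rw [hτj]
      exact hE.mul_nuLE _ _ _
    by_cases hj : σ j = j
    · by_cases h1 : σ = 1
      · subst h1
        simp [hE.diag, nuLE_refl]
      · obtain ⟨i, hi⟩ : ∃ i, σ i ≠ i := by
          by_contra! hall
          exact h1 (Equiv.ext hall)
        -- Since `E j j = 1`, the full product may be cut open at the moved point `i` instead; the
        -- bound 1 is rewritten as `E (σ i) (σ i)`.
        rw [← hE.prod_eq_prod_erase hj, ← Finset.mul_prod_erase _ _ (Finset.mem_univ i), hj,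
          hE.diag, ← hE.diag (σ i)]
        exact ((moved i hi).mul_left _).trans (hE.mul_nuLE _ _ _)
    · exact moved j hj

/-- Opening the product at a moved point bounds it by a 2-cycle. -/
theorem prod_nuLT_one (hE : IsQuasiIdentity E) {σ : Equiv.Perm (Fin n)} (h : σ ≠ 1) :
    NuLT (∏ k, E (σ k) k) 1 := by
  obtain ⟨i, hi⟩ : ∃ i, σ i ≠ i := by
    by_contra! hall
    exact h (Equiv.ext hall)
  rw [← Finset.mul_prod_erase _ _ (Finset.mem_univ i)]
  exact ((hE.prod_erase_nuLE σ i).mul_left _).trans_lt (hE.mul_nuLT_one hi)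

theorem permanent_eq_one (hE : IsQuasiIdentity E) : E.permanent = 1 := by
  have h1 : ∏ k, E ((1 : Equiv.Perm (Fin n)) k) k = 1 := by simp [hE.diag]
  rw [permanent, sum_eq_of_dominant (Finset.mem_univ 1), h1]
  · rw [h1]; exact zero_nuLT_of_isTangible isTangible_one
  · intro σ _ hσ
    rw [h1]; exact hE.prod_nuLT_one hσ

/-- On the diagonal the identity permutation dominates. Off it, all terms are ghosts bounded by `E i
j`, and the transposition of `i` and `j` attains this bound. -/
theorem adj_eq (hE : IsQuasiIdentity E) : adj E = E := by
  ext i j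
  rw [adj_apply]
  by_cases hij : i = j
  · subst hij
    have h1 : (if (1 : Equiv.Perm (Fin n)) i = i then
        ∏ k ∈ Finset.univ.erase i, E ((1 : Equiv.Perm (Fin n)) k) k else 0) = 1 := by
      simp [hE.diag]
    rw [hE.diag, sum_eq_of_dominant (Finset.mem_univ 1), h1]
    · rw [h1]; exact zero_nuLT_of_isTangible isTangible_one
    · intro σ _ hσ
      rw [h1]
      split_ifs with h
      · rw [← hE.prod_eq_prod_erase h]
        exact hE.prod_nuLT_one hσ
      · exact zero_nuLT_of_isTangible isTangible_one
  · refine eq_of_mem_ghost (Submodule.sum_mem _ fun σ _ => ?_) (hE.offDiag i j hij)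
      (sum_nuLE fun σ _ => ?_) ?_
    · split_ifs with h
      · have hj : σ j ≠ j := fun e => hij (σ.injective (h.trans e.symm))
        rw [← Finset.mul_prod_erase _ _ (show j ∈ Finset.univ.erase i by simp [Ne.symm hij])]
        exact Ideal.mul_mem_right _ _ (hE.offDiag _ _ hj)
      · exact Submodule.zero_mem _
    · split_ifs with h
      · subst h
        exact hE.prod_erase_nuLE σ i
      · exact zero_nuLE _
    · refine NuLE.trans ?_ (nuLE_sum _ (Finset.mem_univ (Equiv.swap i j)))
      rw [if_pos (Equiv.swap_apply_left i j), Finset.prod_eq_single j]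
      · rw [Equiv.swap_apply_right]
        exact nuLE_refl _
      · intro k hk hkj
        rw [Equiv.swap_apply_of_ne_of_ne (Finset.ne_of_mem_erase hk) hkj, hE.diag]
      · simp [Ne.symm hij]

theorem nabla_eq (hE : IsQuasiIdentity E) : nabla E = E := by
  rw [nabla, hE.permanent_eq_one, Ring.inverse_one, one_smul, hE.adj_eq]

theorem nabla_diagonal_mul (hE : IsQuasiIdentity E) (d : Fin n → Fˣ) (σ : Equiv.Perm (Fin n)) :
    nabla (diagonal (fun i => (d i : F)) * E.submatrix σ id) =
      E.submatrix id σ * diagonal fun i => (((d i)⁻¹ : Fˣ) : F) := by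
  rw [nabla_diagonal_mul_submatrix, hE.nabla_eq]

theorem nonsingular (hE : IsQuasiIdentity E) (d : Fin n → Fˣ) (σ : Equiv.Perm (Fin n)) :
    Nonsingular (diagonal (fun i => (d i : F)) * E.submatrix σ id) := by
  rw [Nonsingular, permanent_diagonal_mul, permanent_permute_cols, hE.permanent_eq_one, mul_one,
    isTangible_iff_isUnit, ← Units.coe_prod]
  exact Units.isUnit _

theorem diagonal_inv_mul (d : Fin n → Fˣ) :
    (diagonal (fun i => (((d i)⁻¹ : Fˣ) : F)) * diagonal fun i => (d i : F)) = 1 := by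
  simp [diagonal_mul_diagonal]

theorem submatrix_mul (hE : IsQuasiIdentity E) (σ : Equiv.Perm (Fin n)) :
    E.submatrix σ id * E = E.submatrix σ id := by
  conv_lhs => rw [← submatrix_id_id E, submatrix_submatrix, Function.id_comp, Function.id_comp]
  rw [← Matrix.submatrix_mul _ _ _ _ _ Function.bijective_id, hE.idem]

/-- For `A` obtained from `E` by row operations these cancel in `nabla A * A = E`, and `A * E = A`.
-/
theorem closed (hE : IsQuasiIdentity E) (d : Fin n → Fˣ) (σ : Equiv.Perm (Fin n)) :
    IsClosedFamily (diagonal (fun i => (d i : F)) * E.submatrix σ id) := by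
  have h : E.submatrix id σ * E.submatrix σ id = E := by
    rw [submatrix_mul_equiv, hE.idem, submatrix_id_id]
  change quasiId (diagonal (fun i => (d i : F)) * E.submatrix σ id) *
    (diagonal (fun i => (d i : F)) * E.submatrix σ id) = _
  rw [quasiId, hE.nabla_diagonal_mul]
  simp only [Matrix.mul_assoc]
  rw [← Matrix.mul_assoc (diagonal _) (diagonal _), diagonal_inv_mul, Matrix.one_mul, h,
    hE.submatrix_mul]
  rfl

end IsQuasiIdentity

/-- A closed nonsingular matrix with unit diagonal is a quasi-identity matrix. -/
theorem IsQuasiIdentity.of_closed {E : Matrix (Fin n) (Fin n) F} (h1 : ∀ i, E i i = 1)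
    (hperm : E.permanent = 1) (hc : quasiId E * E = E) :
    IsQuasiIdentity E := by
  -- The identity permutation contributes 1 to each diagonal entry of `nabla E`.
  have hI : ∀ i j, NuLE (E i j) (quasiId E i j) := fun i j => by
    have hjj : NuLE 1 (nabla E j j) := by
      rw [nabla, hperm, Ring.inverse_one, one_smul, adj_apply]
      refine NuLE.trans ?_ (nuLE_sum _ (Finset.mem_univ 1))
      simp [h1, nuLE_refl]
    have h := (hjj.mul_left (E i j)).trans
      (nuLE_sum (fun k => E i k * nabla E k j) (Finset.mem_univ j))
    rwa [mul_one, ← mul_apply] at h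
  have hle : ∀ i k j, NuLE (quasiId E i k * E k j) (E i j) := fun i k j => by
    have h := nuLE_sum (fun k => quasiId E i k * E k j) (Finset.mem_univ k)
    rwa [← mul_apply, hc] at h
  have hoff : ∀ i j, i ≠ j → E i j ∈ (ghost : Ideal F) := fun i j hij => by
    have hs : ∑ k, quasiId E i k * E k j = E i j := by rw [← mul_apply, hc]
    rw [← hs]
    -- The summand at `j` is the ghost `quasiId E i j`, which already bounds the whole sum `E i j`.
    refine sum_mem_ghost_of_nuLE (Finset.mem_univ j)
      (Ideal.mul_mem_right _ _ (quasiId_apply_mem_ghost E hij)) ?_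
    rw [hs, h1, mul_one]
    exact hI i j
  have hmul : ∀ i k j, NuLE (E i k * E k j) (E i j) := fun i k j =>
    ((hI i k).mul_right _).trans (hle i k j)
  refine ⟨h1, hoff, ?_⟩
  ext i j
  rw [mul_apply]
  by_cases hij : i = j
  · subst hij
    rw [sum_eq_of_dominant (Finset.mem_univ i)]
    · rw [h1, mul_one]
    · rw [h1, mul_one]; exact zero_nuLT_of_isTangible isTangible_one
    · intro k _ hk
      rw [h1, mul_one]
      refine NuLE.trans_lt ((hI i k).mul_right _) (NuLT.of_not_le fun h => ?_)
      have hs : ∑ k, quasiId E i k * E k i = 1 := by rw [← mul_apply, hc, h1]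
      refine one_not_mem_ghost (F := F) ?_
      rw [← hs] at h ⊢
      exact sum_mem_ghost_of_nuLE (Finset.mem_univ k)
        (Ideal.mul_mem_right _ _ (quasiId_apply_mem_ghost E hk.symm)) h
  · refine eq_of_mem_ghost (Submodule.sum_mem _ fun k _ => ?_) (hoff i j hij)
      (sum_nuLE fun k _ => hmul i k j) ?_
    · by_cases hik : i = k
      · subst hik
        exact Ideal.mul_mem_left _ _ (hoff i j hij)
      · exact Ideal.mul_mem_right _ _ (hoff i k hik)
    · have h := nuLE_sum (fun k => E i k * E k j) (Finset.mem_univ i)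
      rwa [h1, one_mul] at h

/-- A closed nonsingular matrix is a quasi-identity matrix up to permuting and rescaling rows. -/
theorem exists_quasiIdentity {A : Matrix (Fin n) (Fin n) F} (hA : Nonsingular A)
    (hc : quasiId A * A = A) : ∃ (E : Matrix (Fin n) (Fin n) F) (d : Fin n → Fˣ)
      (σ : Equiv.Perm (Fin n)), IsQuasiIdentity E ∧
        A = diagonal (fun i => (d i : F)) * E.submatrix σ id := by
  -- A tangible permanent equals one of its terms, so the entries along `τ` are units; moving them
  -- to the diagonal and dividing gives `E`.
  obtain ⟨τ, -, hτ⟩ := exists_sum_eq_of_isTangible Finset.univ _ hA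
  have hunit : ∀ k, IsUnit (A (τ k) k) := fun k => by
    have h : IsUnit (∏ k, A (τ k) k) := by
      rw [← hτ]
      exact isTangible_iff_isUnit.1 hA
    exact isUnit_of_dvd_unit 
      (Finset.dvd_prod_of_mem (fun k => A (τ k) k) (Finset.mem_univ k)) h
  choose u hu using hunit
  set d : Fin n → Fˣ := fun i => u (τ⁻¹ i) with hd
  set E : Matrix (Fin n) (Fin n) F := diagonal (fun k => (((u k)⁻¹ : Fˣ) : F)) * A.submatrix τ id with hE
  have hAE : A = diagonal (fun i => (d i : F)) * E.submatrix (τ⁻¹ : Equiv.Perm (Fin n)) id := by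
    ext i j
    simp [hE, hd, diagonal_mul]
  have hEp : E.permanent = 1 := by
    rw [hE, permanent_diagonal_mul, permanent_permute_cols]
    rw [permanent, hτ, ← Finset.prod_mul_distrib]
    exact Finset.prod_eq_one fun k _ => by rw [← hu, Units.inv_mul]
  refine ⟨E, d, τ⁻¹, IsQuasiIdentity.of_closed (fun i => ?_) hEp ?_, hAE⟩
  · simp [hE, diagonal_mul, ← hu]
  · have hN : nabla E = (nabla A).submatrix id τ * diagonal fun k => (u k : F) := by
      rw [hE, nabla_diagonal_mul_submatrix]
      simp
    -- `nabla A * A` is unchanged by these row operations, so closedness passes from `A` to `E`.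
    have hm : ((nabla A).submatrix id τ * diagonal fun k => (u k : F)) * E =
        nabla A * A := by
      rw [hE, Matrix.mul_assoc, ← Matrix.mul_assoc (diagonal _) (diagonal _)]
      simp [diagonal_mul_diagonal]
    rw [quasiId, Matrix.mul_assoc, hN, hm, hE, Matrix.mul_assoc]
    congr 1
    ext i j
    have := congrFun (congrFun hc (τ i)) j
    rw [quasiId, Matrix.mul_assoc] at this
    simpa [mul_apply] using this

end QuasiIdentity

/-! ### Bases of the dual space. -/

section Dual

variable {F : Type*} [SupertropicalSemifield F]

theorem mem_ghostFun {X : Type*} {f : X → F} :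
    f ∈ ghostFun F X ↔ ∀ x, f x ∈ (ghost : Ideal F) := by
  simp [ghostFun]

/-- The coefficients need not be tangible: terms with ghost coefficients are absorbed into the ghost
remainder. -/
theorem tropicallySpanned_range {X : Type*} {ι : Type*} [Fintype ι] {ε : ι → X → F}
    (hε : Function.Injective ε) (a : ι → F) {l : X → F}
    (h : ∀ x, GhostSurpasses (ghost : Ideal F) (l x) (∑ i, a i * ε i x)) :
    TropicallySpanned (ghostFun F X) (Set.range ε) l := by
  classical
  choose g hg hl using h
  refine ⟨(Finset.univ.filter fun i => IsTangible (a i)).image ε, ?_, Function.extend ε a 0, ?_,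
    fun x => (∑ i with ¬ IsTangible (a i), a i * ε i x) + g x, ?_, ?_⟩
  · simp [Set.subset_def]
  · simp only [Finset.mem_image, Finset.mem_filter]
    rintro _ ⟨i, ⟨-, hi⟩, rfl⟩
    rwa [hε.extend_apply]
  · refine mem_ghostFun.2 fun x => Submodule.add_mem _ (Submodule.sum_mem _ fun i hi => ?_) (hg x)
    exact Ideal.mul_mem_right _ _ (not_not.1 (Finset.mem_filter.1 hi).2)
  · rw [Finset.sum_image hε.injOn]
    ext x
    simp only [hε.extend_apply, Pi.add_apply, Finset.sum_apply, Pi.smul_apply, smul_eq_mul]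
    rw [← add_assoc, Finset.sum_filter_add_sum_filter_not, hl]

/-- A tropically independent set which tropically spans is a d-base. -/
theorem IsDBase.of_spanned {X : Type*} {V : Submodule F (X → F)} {S : Set (X → F)}
    (hS : S ⊆ V) (hi : TropicallyIndependent (ghostFun F X) S)
    (hs : ∀ v ∈ V, TropicallySpanned (ghostFun F X) S v) : IsDBase (ghostFun F X) V S := by
  classical
  refine ⟨hS, hi, fun S' hS' hSS' hi' => (Set.Subset.antisymm hSS' fun l hl => ?_).symm⟩
  by_contra hlS
  obtain ⟨t, ht, α, hα, u, hu, e⟩ := hs l (hS' hl)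
  have hlt : l ∉ t := fun h => hlS (ht h)
  have hne : ∀ w ∈ t, w ≠ l := fun w hw h => hlt (h ▸ hw)
  -- Adding to `l` the combination `s` that it surpasses gives `s + s + u`, a ghost.
  refine hi' ⟨insert l t, Finset.insert_nonempty _ _, ?_, Function.update α l 1, ?_, ?_⟩
  · rw [Finset.coe_insert]
    exact Set.insert_subset hl (ht.trans hSS')
  · intro w hw
    rcases Finset.mem_insert.1 hw with rfl | hw
    · rw [Function.update_self]
      exact isTangible_one
    · rw [Function.update_of_ne (hne w hw)]
      exact hα w hw
  · rw [Finset.sum_insert hlt, Function.update_self, one_smul,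
      Finset.sum_congr rfl fun w hw => by rw [Function.update_of_ne (hne w hw)], e, add_right_comm]
    exact Submodule.add_mem _ (mem_ghostFun.2 fun x => add_self_mem_ghost _) hu

theorem dualSpace_map_sum {V : Type*} [AddCommMonoid V] [Module F V] {H : Submodule F V}
    {l : V → F} (hl : l ∈ dualSpace H) {ι : Type*} (s : Finset ι) (f : ι → V) :
    GhostSurpasses (ghost : Ideal F) (l (∑ i ∈ s, f i)) (∑ i ∈ s, l (f i)) := by
  classical
  obtain ⟨hadd, hsmul, -⟩ := hl
  induction s using Finset.induction_on with
  | empty =>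
    refine ⟨0, Submodule.zero_mem _, ?_⟩
    simpa using hsmul 0 0
  | insert a s ha ih =>
    obtain ⟨u, hu, e⟩ := ih
    obtain ⟨u', hu', e'⟩ := hadd (f a) (∑ i ∈ s, f i)
    refine ⟨u + u', Submodule.add_mem _ hu hu', ?_⟩
    rw [Finset.sum_insert ha, Finset.sum_insert ha, e', e]
    abel

variable {n : ℕ}

/-- No nonempty combination of columns of a quasi-identity matrix with tangible coefficients is
ghost on the rows of the same index set. -/
theorem IsQuasiIdentity.exists_isTangible_sum {Q : Matrix (Fin n) (Fin n) F}
    (hQ : IsQuasiIdentity Q) {T : Finset (Fin n)} (hT : T.Nonempty) {c : Fin n → F}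
    (hc : ∀ i ∈ T, IsTangible (c i)) : ∃ k ∈ T, IsTangible (∑ i ∈ T, c i * Q k i) := by
  by_contra! hghost
  -- Otherwise the tangible diagonal term `c k` would dominate row `k`.
  have hnext : ∀ k ∈ T, ∃ i ∈ T, i ≠ k ∧ NuLE (c k) (c i * Q k i) := by
    intro k hk
    by_contra! hno
    refine hghost k hk ?_
    have hkk : c k * Q k k = c k := by rw [hQ.diag, mul_one]
    rw [sum_eq_of_dominant hk, hkk]
    · exact hc k hk
    · rw [hkk]
      exact zero_nuLT_of_isTangible (hc k hk)
    · intro i hi hik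
      rw [hkk]
      exact NuLT.of_not_le (hno i hi hik)
  -- The triangle inequality and the strict bound on 2-cycles make `r` a strict order; on a finite
  -- set it has a minimal element, contradicting `hnext`.
  let r : T → T → Prop := fun i k => i ≠ k ∧ NuLE (c k) (c i * Q k i)
  have : Std.Irrefl r := ⟨fun i h => h.1 rfl⟩
  have : IsTrans T r := ⟨by
    rintro j i k ⟨hji, h1⟩ ⟨hik, h2⟩
    have hcomp : NuLE (c k) (c j * (Q k i * Q i j)) := by
      refine h2.trans ?_
      rw [show c j * (Q k i * Q i j) = c j * Q i j * Q k i by ring]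
      exact h1.mul_right _
    refine ⟨?_, hcomp.trans ((hQ.mul_nuLE _ _ _).mul_left _)⟩
    rintro rfl
    refine (hQ.mul_nuLT_one (i := j) (k := i) fun h => hji (Subtype.ext h)).2 ?_
    refine NuLE.of_mul_left (isTangible_iff_isUnit.1 (hc j j.2)) ?_
    rwa [mul_one]⟩
  obtain ⟨k, hk⟩ := hT
  obtain ⟨m, -, hm⟩ := (Finite.wellFounded_of_trans_of_irrefl r).has_min Set.univ ⟨⟨k, hk⟩, trivial⟩
  obtain ⟨i, hi, him, hle⟩ := hnext m m.2
  exact hm ⟨i, hi⟩ trivial ⟨fun h => him (congrArg Subtype.val h), hle⟩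

/-- Let `Q` be a quasi-identity matrix with rows in `W`, acting identically on `W`. Then the
coordinate functionals, up to permutation and tangible multiples, are both an s-base and a d-base
of the dual space of `W`. -/
theorem dual_bases_of_quasiIdentity {W : Submodule F (Fin n → F)} {Q : Matrix (Fin n) (Fin n) F}
    (hQ : IsQuasiIdentity Q) (hrow : ∀ j, Q j ∈ W) (hW : ∀ v ∈ W, v ᵥ* Q = v) (u : Fin n → Fˣ)
    (σ : Equiv.Perm (Fin n)) {ε : Fin n → W → F}
    (hε : ∀ (i : Fin n) (v : W), ε i v = u i * (v : Fin n → F) (σ i)) :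
    Function.Injective ε ∧
    IsSBase (ghostFun F W) (dualSpace ((ghostFun F (Fin n)).comap W.subtype)) (Set.range ε) ∧
    IsDBase (ghostFun F W) (dualSpace ((ghostFun F (Fin n)).comap W.subtype)) (Set.range ε) := by
  classical
  -- An approximate dual family: `ε i (q k)` is a unit for `i = k` and a ghost otherwise.
  let q : Fin n → W := fun k => ⟨Q (σ k), hrow (σ k)⟩
  have hq : ∀ i k, ε i (q k) = u i * Q (σ k) (σ i) := fun i k => hε i (q k)
  have hqq : ∀ k, ε k (q k) = u k := fun k => by rw [hq, hQ.diag, mul_one]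
  have hutan : ∀ k, IsTangible (u k : F) := fun k => isTangible_iff_isUnit.2 (u k).isUnit
  have hqg : ∀ i k, i ≠ k → ε i (q k) ∈ (ghost : Ideal F) := fun i k h => by
    rw [hq]
    exact Ideal.mul_mem_left _ _ (hQ.offDiag _ _ fun e => h (σ.injective e.symm))
  have hinj : Function.Injective ε := fun i k h => by
    by_contra hik
    refine hutan k ?_
    rw [← hqq, ← h]
    exact hqg i k hik
  have hmem : Set.range ε ⊆ dualSpace ((ghostFun F (Fin n)).comap W.subtype) := by
    rintro _ ⟨i, rfl⟩
    refine ⟨fun v w => ⟨0, Submodule.zero_mem _, ?_⟩, fun a v => ?_, fun v hv => ?_⟩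
    · simp [hε, mul_add]
    · simp [hε, mul_left_comm]
    · rw [hε]
      exact Ideal.mul_mem_left _ _ (mem_ghostFun.1 hv (σ i))
  have hspan : ∀ l ∈ dualSpace ((ghostFun F (Fin n)).comap W.subtype),
      TropicallySpanned (ghostFun F W) (Set.range ε) l := by
    intro l hl
    -- The coefficients come from applying `l` to `v = ∑ i, v (σ i) • q i`.
    refine tropicallySpanned_range hinj (fun i => l (q i) * ((u i)⁻¹ : Fˣ)) fun v => ?_
    have hv : v = ∑ i, (v : Fin n → F) (σ i) • q i := by
      ext m
      conv_lhs => rw [← hW v v.2]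
      simp only [vecMul, dotProduct, Submodule.coe_sum, Submodule.coe_smul, Finset.sum_apply,
        Pi.smul_apply, smul_eq_mul, q]
      rw [Equiv.sum_comp σ fun j => (v : Fin n → F) j * Q j m]
    have h := dualSpace_map_sum hl Finset.univ fun i => (v : Fin n → F) (σ i) • q i
    rw [← hv] at h
    convert h using 2 with i
    rw [hl.2.1, hε, mul_assoc, Units.inv_mul_cancel_left, mul_comm]
  have hindep : TropicallyIndependent (ghostFun F W) (Set.range ε) := by
    rintro ⟨t, ht, htr, α, hα, hsum⟩
    set T : Finset (Fin n) := Finset.univ.filter fun i => ε i ∈ t with hTdef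
    have hmemT : ∀ {i}, i ∈ T ↔ ε i ∈ t := by simp [hTdef]
    have htT : T.image ε = t := by
      ext w
      rw [Finset.mem_image]
      constructor
      · rintro ⟨i, hi, rfl⟩
        exact hmemT.1 hi
      · intro hw
        obtain ⟨i, rfl⟩ := htr hw
        exact ⟨i, hmemT.2 hw, rfl⟩
    have hT : T.Nonempty := by rwa [← htT, Finset.image_nonempty] at ht
    have hperm : IsQuasiIdentity (Q.submatrix σ σ) :=
      ⟨fun i => hQ.diag _, fun i j h => hQ.offDiag _ _ fun e => h (σ.injective e), by
        rw [submatrix_mul_equiv, hQ.idem]⟩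
    obtain ⟨k, -, hk⟩ := hperm.exists_isTangible_sum hT (c := fun i => α (ε i) * u i)
      fun i hi => mul_not_mem_ghost _ _ (hα _ (hmemT.1 hi)) (hutan i)
    refine hk ?_
    have := mem_ghostFun.1 hsum (q k)
    rw [← htT, Finset.sum_image hinj.injOn] at this
    simpa [hq, mul_assoc] using this
  refine ⟨hinj, ⟨hmem, hspan, fun S' hS' hall => ?_⟩, .of_spanned hmem hindep hspan⟩
  -- If `ε k` is omitted, all the others are ghost at `q k`, whereas `ε k (q k) = u k` is tangible.
  obtain ⟨_, ⟨k, rfl⟩, hk⟩ := Set.exists_of_ssubset hS'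
  obtain ⟨t, ht, α, -, g, hg, e⟩ := hall (ε k) (hmem ⟨k, rfl⟩)
  refine hutan k ?_
  rw [← hqq, e, Pi.add_apply, Finset.sum_apply]
  refine Submodule.add_mem _ (Submodule.sum_mem _ fun w hw => ?_) (mem_ghostFun.1 hg _)
  obtain ⟨i, rfl⟩ := hS'.1 (ht hw)
  refine Ideal.mul_mem_left _ _ (hqg i k ?_)
  rintro rfl
  exact hk (ht hw)

/-- For singular `A` the matrix `I_A` is not defined and `nabla A` is set to `0`; a closed
tropically independent family is therefore nonsingular. -/
theorem nonsingular_of_closed {H : Submodule F (Fin n → F)} {b : Fin n → Fin n → F}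
    (hi : TropicallyIndependent H (Set.range b)) (hc : IsClosedFamily b) :
    Nonsingular (Matrix.of b) := by
  by_contra hs
  have hN : nabla (Matrix.of b) = 0 := by
    rw [nabla, Ring.inverse_non_unit _ fun h => hs (isTangible_iff_isUnit.2 h), zero_smul]
  have hb : (0 : Matrix (Fin n) (Fin n) F) = Matrix.of b := by
    rw [← hc, closureMatrix, quasiId, hN, Matrix.mul_zero, Matrix.zero_mul]
  rcases isEmpty_or_nonempty (Fin n) with h | ⟨⟨i⟩⟩
  · exact hs (by rw [Nonsingular, permanent_isEmpty]; exact isTangible_one)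
  · refine hi ⟨{b i}, Finset.singleton_nonempty _, by simp, fun _ => 1,
      fun _ _ => isTangible_one, ?_⟩
    have : b i = 0 := (congrFun hb i).symm
    simp [this]

end Dual

end Supertropical

/-! ### The theorem: rows through `E`, columns through `I_A`. -/

open Supertropical Matrix in
theorem theorem6 {F : Type*} [SupertropicalSemifield F] {n : ℕ}
    (V : Submodule F (Fin n → F)) (b : Fin n → Fin n → F) (hinj : Function.Injective b)
    (hs : IsSBase (ghostFun F (Fin n) ⊓ V) V (Set.range b))
    (hd : IsDBase (ghostFun F (Fin n) ⊓ V) V (Set.range b))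
    (hclosed : IsClosedFamily b) :
    IsClosedSBaseOfDual (rowSpace b) (rowDual b) (fun i => (nabla (Matrix.of b))ᵀ i) ∧
    IsClosedSBaseOfDual (colSpace b) (colDual b) (fun i => b i ᵥ* nabla (Matrix.of b)) := by
  have hns := nonsingular_of_closed hd.2.1 hclosed
  set A : Matrix (Fin n) (Fin n) F := Matrix.of b with hA
  have hcm : closureMatrix b = A := hclosed
  have hIA : quasiId A * A = A := hclosed
  constructor
  · obtain ⟨E, d, σ, hE, hAE⟩ := exists_quasiIdentity hns hIA
    have hN : nabla A = E.submatrix id σ * diagonal fun i => (((d i)⁻¹ : Fˣ) : F) := by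
      rw [hAE, hE.nabla_diagonal_mul]
    have hC : (nabla A)ᵀ = diagonal (fun i => (((d i)⁻¹ : Fˣ) : F)) * Eᵀ.submatrix σ id := by
      rw [hN, transpose_mul, diagonal_transpose, transpose_submatrix]
    have hA_mul : A * E = A := by
      rw [hAE, Matrix.mul_assoc, hE.submatrix_mul]
    have hrow : ∀ j, E j ∈ rowSpace b := fun j => by
      have h : E j = (((d (σ⁻¹ j))⁻¹ : Fˣ) : F) • A (σ⁻¹ j) := by
        ext m
        rw [hAE]
        simp [diagonal_mul]
      rw [h]
      refine Submodule.smul_mem _ _ (Submodule.subset_span ⟨σ⁻¹ j, ?_⟩)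
      simp only [hcm]
    have hW : ∀ v ∈ rowSpace b, v ᵥ* E = v := fun v hv => by
      induction hv using Submodule.span_induction with
      | mem x hx =>
        obtain ⟨i, rfl⟩ := hx
        simp only [hcm]
        exact congrFun hA_mul i
      | zero => exact zero_vecMul _
      | add x y _ _ hx hy => rw [add_vecMul, hx, hy]
      | smul a x _ hx => rw [smul_vecMul, hx]
    have hε : ∀ (i : Fin n) (v : rowSpace b),
        rowDual b i v = ((d i)⁻¹ : Fˣ) * (v : Fin n → F) (σ i) := fun i v => by
      have h := congrFun (hW v v.2) (σ i)
      rw [rowDual, ← hA, hN, ← vecMul_vecMul, vecMul_diagonal, mul_comm, ← h]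
      rfl
    obtain ⟨h1, h2, h3⟩ := dual_bases_of_quasiIdentity hE hrow hW _ σ hε
    refine ⟨fun i v => dotProduct_comm (v : Fin n → F) ((nabla A)ᵀ i), h1, h2, h3, ?_, ?_⟩
    · change Supertropical.Nonsingular (nabla A)ᵀ
      rw [hC]
      exact hE.transpose.nonsingular _ σ
    · change IsClosedFamily (nabla A)ᵀ
      rw [hC]
      exact hE.transpose.closed _ σ
  -- Idempotency is `I_A I_A = (I_A A) A^∇ = A A^∇`.
  · have hI : IsQuasiIdentity (quasiId A) :=
      ⟨quasiId_apply_self hns, fun i j h => quasiId_apply_mem_ghost A h, by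
        conv_lhs => rw [quasiId, ← Matrix.mul_assoc, ← quasiId, hIA]
        rfl⟩
    have hone : quasiId A =
        diagonal (fun _ => ((1 : Fˣ) : F)) * (quasiId A).submatrix (1 : Equiv.Perm (Fin n)) id := by
      ext i j
      simp
    have hrow : ∀ j, (quasiId A)ᵀ j ∈ colSpace b := fun j => by
      refine ⟨fun k => nabla A k j, ?_⟩
      rw [mulVecLin_apply, hcm]
      rfl
    have hW : ∀ v ∈ colSpace b, v ᵥ* (quasiId A)ᵀ = v := by
      rintro _ ⟨x, rfl⟩
      rw [mulVecLin_apply, hcm, vecMul_transpose, mulVec_mulVec, hIA]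
    -- `b_iᵗ A^∇ v` is the `i`-th coordinate of `I_A v = v`.
    have hε : ∀ (i : Fin n) (v : colSpace b),
        colDual b i v = ((1 : Fˣ) : F) * (v : Fin n → F) ((1 : Equiv.Perm (Fin n)) i) :=
      fun i v => by
        have h := congrFun (hW v v.2) i
        rw [vecMul_transpose, quasiId, ← mulVec_mulVec] at h
        rw [Units.val_one, one_mul, Equiv.Perm.one_apply, ← h]
        rfl
    obtain ⟨h1, h2, h3⟩ := dual_bases_of_quasiIdentity hI.transpose hrow hW _ 1 hε
    refine ⟨fun i v => dotProduct_mulVec _ _ _, h1, h2, h3, ?_, ?_⟩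
    · change Supertropical.Nonsingular (quasiId A)
      rw [hone]
      exact hI.nonsingular _ 1
    · change IsClosedFamily (quasiId A)
      rw [hone]
      exact hI.closed _ 1
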